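/- **Setting.** Let $\Omega\subset\mathbb R^2$ be a polygonal domain, i.e. a connected open set that is the interior of a finite union of closed triangles. Let $\mathcal T_h$ be a finite partition of $\Omega$ into pairwise disjoint open polygons $K$ (connected, possibly non-convex), $\bigcup_K\overline K=\overline\Omega$. It is assumed shape regular with parameters $N\in\mathbb N$ and $\sigma\in\mathbb R$: every $K$ is subdivided into at most $N$ triangles, these triangles together form a conforming triangulation, and each of them satisfies $h_T/\rho_T\le\sigma$, where $h_T$ is its diameter and $\rho_T$ the radius of its greatest inscribed ball. Let $\Gamma_h=\bigcup_K\partial K$ be divided into finitely many straight edges $e$ of length $h_e$ with pairwise disjoint relative interiors, each either an interior edge $e\subset\partial K^+\cap\partial K^-$ between two different elements lying on its two sides, or a boundary edge $e\subset\partial K\cap\partial\Omega$. On an interior edge, let $\mathbf n^\pm$ be the unit normals outward from $K^\pm$ and put $\{\nabla\mathbf v\}=\frac12(\nabla\mathbf v^++\nabla\mathbf v^-)$, $[\![\mathbf v\otimes\mathbf n]\!]=\mathbf v^+\otimes\mathbf n^++\mathbf v^-\otimes\mathbf n^-$, $[\![\mathbf v\cdot\mathbf n]\!]=\mathbf v^+\cdot\mathbf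 n^++\mathbf v^-\cdot\mathbf n^-$; on a boundary edge put $\{\nabla\mathbf v\}=\nabla\mathbf v$, $[\![\mathbf v\otimes\mathbf n]\!]=\mathbf v\otimes\mathbf n$, $[\![\mathbf v\cdot\mathbf n]\!]=\mathbf v\cdot\mathbf n$, with $\mathbf n$ outward. Let $m\ge 0$ be an integer and let $\mathbb S_m$ be the space of divergence-free polynomial vector fields with components of total degree at most $m$. For each $K$ let a sampling node $\mathbf x_K\in K$ and a patch $S(K)$ of elements with $K\in S(K)$ be given, such that every $\mathbf p\in\mathbb S_m$ vanishing at all nodes $\mathbf x_{K'}$, $K'\in S(K)$, vanishes on $S(K)$. For a piecewise constant vector field $\mathbf w$ let $\mathcal S\mathbf w$ be the piecewise polynomial field with $(\mathcal S\mathbf w)|_K=\arg\min_{\mathbf p\in\mathbb S_m}\sum_{K'\in S(K)}|\mathbf w(\mathbf x_{K'})-\mathbf p(\mathbf x_{K'})|^2$, and let $\mathbf V_h$ be the set of all $\mathcal S\mathbf w$. For penalty parameters $\eta,\epsilon$ (real numbers, or more generally real-valued functions that are constant on each edge, with values $\eta_e,\epsilon_e$) let $$B_h(\mathbf u,\mathbf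 v)=\sum_K\int_K\nabla\mathbf u:\nabla\mathbf v-\sum_e\int_e[\![\mathbf u\otimes\mathbf n]\!]:\{\nabla\mathbf v\}-\sum_e\int_e\{\nabla\mathbf u\}:[\![\mathbf v\otimes\mathbf n]\!]+\sum_e\eta_e\int_e[\![\mathbf u\otimes\mathbf n]\!]:[\![\mathbf v\otimes\mathbf n]\!]+\sum_e\epsilon_e\int_e[\![\mathbf u\cdot\mathbf n]\!]\,[\![\mathbf v\cdot\mathbf n]\!],$$ $$\|\mathbf v\|_h^2=\sum_K\|\nabla\mathbf v\|_{L^2(K)}^2+\sum_e h_e^{-1}\|[\![\mathbf v\otimes\mathbf n]\!]\|_{L^2(e)}^2+\sum_e h_e^{-(m+1)}\|[\![\mathbf v\cdot\mathbf n]\!]\|_{L^2(e)}^2 .$$ **Lemma.** There are constants $\eta_0,\epsilon_0,c>0$ depending only on $N,\sigma,m$, and for every $A\in\mathbb R$ a constant $C>0$ depending only on $N,\sigma,m,A$, such that for all $\Omega$, $\mathcal T_h$, nodes and patches as above and all penalty parameters with $\eta_e\ge\eta_0h_e^{-1}$ and $\epsilon_e\ge\epsilon_0h_e^{-(m+1)}$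 on every edge $e$: 1. (boundedness) if moreover $\eta_e\le A\,h_e^{-1}$ and $\epsilon_e\le A\,h_e^{-(m+1)}$ on every edge $e$, then $|B_h(\mathbf u_h,\mathbf v_h)|\le C\,\|\mathbf u_h\|_h\,\|\mathbf v_h\|_h$ for all $\mathbf u_h,\mathbf v_h\in\mathbf V_h$; 2. (coercivity) $B_h(\mathbf v_h,\mathbf v_h)\ge c\,\|\mathbf v_h\|_h^2$ for all $\mathbf v_h\in\mathbf V_h$. -/

import Mathlib

open Set Filter Topology MeasureTheory

noncomputable section

namespace StokesDG

/-- The Euclidean plane. -/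
abbrev Plane : Type := EuclideanSpace ℝ (Fin 2)

/-! ### Triangles and polygons -/

/-- A (nondegenerate) triangle, given by its set of three vertices. -/
def IsTriangle (s : Finset Plane) : Prop :=
  s.card = 3 ∧ AffineIndependent ℝ ((↑) : s → Plane)

/-- The closed triangle with vertex set `s`. -/
def closedTri (s : Finset Plane) : Set Plane := convexHull ℝ (s : Set Plane)

/-- The diameter of a triangle. -/
def triDiam (s : Finset Plane) : ℝ := Metric.diam (closedTri s)

/-- The radius of the greatest ball inscribed in a triangle. -/
def triInradius (s : Finset Plane) : ℝ :=
  sSup {r : ℝ | 0 ≤ r ∧ ∃ c : Plane, Metric.closedBall c r ⊆ closedTri s}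

/-- The open region covered by finitely many triangles. -/
def region (S : Finset (Finset Plane)) : Set Plane := interior (⋃ s ∈ S, closedTri s)

/-- Open polygons: connected open sets that are the interior of a finite union of triangles. They
may be non-convex or multiply connected. -/
def IsPolygon (D : Set Plane) : Prop :=
  IsConnected D ∧ ∃ S : Finset (Finset Plane), (∀ s ∈ S, IsTriangle s) ∧ D = region S

/-! ### Polygonal meshes -/

/-- The polygon `K` lies behind the segment `[a, b]` with respect to the direction `n`: starting
at any point of the open segment, one enters `K` in the direction `-n`. -/
def LiesBehind (K : Set Plane) (a b n : Plane) : Prop :=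
  ∀ x ∈ openSegment ℝ a b, ∀ᶠ t : ℝ in 𝓝[>] 0, x - t • n ∈ K

/-- A partition of `Ω` into finitely many open polygons, together with its edges. Every edge `e` is
a segment `[a e, b e]`. It has an element `pos e` (the element `K⁺`), a unit normal `normal e` that
is outward for `K⁺`, and, if it is an interior edge, a second element `neg e = some K⁻`, for which
`-normal e` is outward. For the edges on `∂Ω`, `neg e = none`. -/
structure PolyMesh (Ω : Set Plane) where
  numElems : ℕ
  elem : Fin numElems → Set Plane
  isPolygon : ∀ K, IsPolygon (elem K)
  disjoint : ∀ K K', K ≠ K' → Disjoint (elem K) (elem K')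
  cover : ⋃ K, closure (elem K) = closure Ω
  numEdges : ℕ
  a : Fin numEdges → Plane
  b : Fin numEdges → Plane
  a_ne_b : ∀ e, a e ≠ b e
  pos : Fin numEdges → Fin numElems
  neg : Fin numEdges → Option (Fin numElems)
  normal : Fin numEdges → Plane
  norm_normal : ∀ e, ‖normal e‖ = 1
  normal_perp : ∀ e, inner ℝ (normal e) (b e - a e) = 0
  pos_subset : ∀ e, segment ℝ (a e) (b e) ⊆ frontier (elem (pos e))
  pos_behind : ∀ e, LiesBehind (elem (pos e)) (a e) (b e) (normal e)
  neg_ne : ∀ e K, neg e = some K → K ≠ pos e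
  neg_subset : ∀ e K, neg e = some K → segment ℝ (a e) (b e) ⊆ frontier (elem K)
  neg_behind : ∀ e K, neg e = some K → LiesBehind (elem K) (a e) (b e) (-normal e)
  boundary_subset : ∀ e, neg e = none → segment ℝ (a e) (b e) ⊆ frontier Ω
  edges_disjoint : ∀ e e', e ≠ e' →
    Disjoint (openSegment ℝ (a e) (b e)) (openSegment ℝ (a e') (b e'))
  /-- The edges make up `Γ_h`, the union of the boundaries of the elements. -/
  edges_cover : ⋃ e, segment ℝ (a e) (b e) = ⋃ K, frontier (elem K)

/-- The regularity of the mesh: every element is decomposed into at most `N` triangles, all these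
triangles together form a compatible (conforming) triangulation, and each of them satisfies
`h_T ≤ σ ρ_T`. -/
def PolyMesh.ShapeRegular {Ω : Set Plane} (M : PolyMesh Ω) (N : ℕ) (σ : ℝ) : Prop :=
  ∃ sub : Fin M.numElems → Finset (Finset Plane),
    (∀ K, (sub K).card ≤ N) ∧
    (∀ K, M.elem K = region (sub K)) ∧
    (∀ K, ∀ s ∈ sub K, IsTriangle s ∧ triDiam s / triInradius s ≤ σ) ∧
    (∀ K K', ∀ s ∈ sub K, ∀ s' ∈ sub K',
      closedTri s ∩ closedTri s' = convexHull ℝ ((s : Set Plane) ∩ (s' : Set Plane)))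

/-! ### Polynomial vector fields -/

/-- Polynomial vector fields on the plane. -/
abbrev PolyField : Type := Fin 2 → MvPolynomial (Fin 2) ℝ

/-- The value of a polynomial vector field at a point. -/
def PolyField.val (p : PolyField) (x : Plane) (i : Fin 2) : ℝ :=
  MvPolynomial.eval (fun k => x k) (p i)

/-- The Jacobian matrix `(∇p)_{ij} = ∂_j p_i` at a point. -/
def PolyField.grad (p : PolyField) (x : Plane) (i j : Fin 2) : ℝ :=
  MvPolynomial.eval (fun k => x k) (MvPolynomial.pderiv j (p i))

/-- The divergence-free polynomial vector fields whose components have total degree at most `m`.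
Since polynomials are determined by their values on any nonempty open set, this does not depend on
the domain. -/
def solenoidal (m : ℕ) : Set PolyField :=
  {p | (∀ i, (p i).totalDegree ≤ m) ∧ ∑ i, MvPolynomial.pderiv i (p i) = 0}

/-! ### The reconstruction and the approximation space -/

/-- A sampling node in every element and a patch of elements around every element. -/
structure PatchData {Ω : Set Plane} (M : PolyMesh Ω) where
  node : Fin M.numElems → Plane
  node_mem : ∀ K, node K ∈ M.elem K
  patch : Fin M.numElems → Finset (Fin M.numElems)
  self_mem : ∀ K, K ∈ patch K

variable {Ω : Set Plane} {M : PolyMesh Ω}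

/-- A field in `solenoidal m` that vanishes at the sampling nodes of a patch vanishes on the whole
patch. -/
def PatchData.Unisolvent (P : PatchData M) (m : ℕ) : Prop :=
  ∀ K, ∀ p ∈ solenoidal m, (∀ K' ∈ P.patch K, p.val (P.node K') = 0) →
    ∀ K' ∈ P.patch K, ∀ x ∈ M.elem K', p.val x = 0

/-- The sum of squares `∑ |w(x) - p(x)|²` over the sampling nodes `x` of the patch of `K`, where
`w` is the piecewise constant vector field with value `w K'` on the element `K'`. -/
def PatchData.residual (P : PatchData M) (w : Fin M.numElems → Fin 2 → ℝ) (K : Fin M.numElems)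
    (p : PolyField) : ℝ :=
  ∑ K' ∈ P.patch K, ∑ i, (w K' i - p.val (P.node K') i) ^ 2

/-- `p = 𝒮_K w`: `p` solves the local least-squares problem. -/
def PatchData.IsReconstruction (P : PatchData M) (m : ℕ) (w : Fin M.numElems → Fin 2 → ℝ)
    (K : Fin M.numElems) (p : PolyField) : Prop :=
  p ∈ solenoidal m ∧ IsMinOn (P.residual w K) (solenoidal m) p

/-- The approximation space `V_h = 𝒮 U_h`. A function in it is given by the polynomial fields `v K`
with which it coincides on the elements `K`; they also give its one-sided traces on the edges. -/
def PatchData.space (P : PatchData M) (m : ℕ) : Set (Fin M.numElems → PolyField) :=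
  {v | ∃ w : Fin M.numElems → Fin 2 → ℝ, ∀ K, P.IsReconstruction m w K (v K)}

/-! ### Averages, jumps, the bilinear form and the energy norm -/

variable (M)

/-- The length `h_e` of an edge. -/
def PolyMesh.edgeLen (e : Fin M.numEdges) : ℝ := dist (M.a e) (M.b e)

/-- The integral over an edge with respect to arc length. -/
def PolyMesh.edgeIntegral (e : Fin M.numEdges) (f : Plane → ℝ) : ℝ :=
  M.edgeLen e * ∫ t in (0 : ℝ)..1, f (AffineMap.lineMap (M.a e) (M.b e) t)

/-- The jump `[[v ⊗ n]]` on an edge. -/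
def PolyMesh.jumpTensor (v : Fin M.numElems → PolyField) (e : Fin M.numEdges) (x : Plane)
    (i j : Fin 2) : ℝ :=
  match M.neg e with
  | some K => (v (M.pos e)).val x i * M.normal e j + (v K).val x i * (-M.normal e) j
  | none => (v (M.pos e)).val x i * M.normal e j

/-- The jump `[[v · n]]` on an edge. -/
def PolyMesh.jumpNormal (v : Fin M.numElems → PolyField) (e : Fin M.numEdges) (x : Plane) : ℝ :=
  match M.neg e with
  | some K => ∑ i, (v (M.pos e)).val x i * M.normal e i + ∑ i, (v K).val x i * (-M.normal e) i
  | none => ∑ i, (v (M.pos e)).val x i * M.normal e i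

/-- The average `{∇v}` on an edge. -/
def PolyMesh.avgGrad (v : Fin M.numElems → PolyField) (e : Fin M.numEdges) (x : Plane)
    (i j : Fin 2) : ℝ :=
  match M.neg e with
  | some K => ((v (M.pos e)).grad x i j + (v K).grad x i j) / 2
  | none => (v (M.pos e)).grad x i j

/-- The bilinear form `B_h` with penalty parameters `η` (on `[[u ⊗ n]]`) and `ε` (on `[[u · n]]`),
which may vary from edge to edge. -/
def PolyMesh.bilin (η ε : Fin M.numEdges → ℝ) (u v : Fin M.numElems → PolyField) : ℝ :=
  (∑ K, ∫ x in M.elem K, ∑ i, ∑ j, (u K).grad x i j * (v K).grad x i j)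
  - (∑ e, M.edgeIntegral e fun x => ∑ i, ∑ j, M.jumpTensor u e x i j * M.avgGrad v e x i j)
  - (∑ e, M.edgeIntegral e fun x => ∑ i, ∑ j, M.avgGrad u e x i j * M.jumpTensor v e x i j)
  + (∑ e, η e * M.edgeIntegral e fun x =>
      ∑ i, ∑ j, M.jumpTensor u e x i j * M.jumpTensor v e x i j)
  + (∑ e, ε e * M.edgeIntegral e fun x => M.jumpNormal u e x * M.jumpNormal v e x)

/-- The energy norm
`‖v‖_h² = ∑_K |v|²_{1,K} + ∑_e h_e⁻¹ ‖[[v ⊗ n]]‖²_e + ∑_e h_e^{-(m+1)} ‖[[v · n]]‖²_e`. -/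
def PolyMesh.energyNorm (m : ℕ) (v : Fin M.numElems → PolyField) : ℝ :=
  Real.sqrt
    ((∑ K, ∫ x in M.elem K, ∑ i, ∑ j, (v K).grad x i j ^ 2)
    + (∑ e, (M.edgeLen e)⁻¹ * M.edgeIntegral e fun x => ∑ i, ∑ j, M.jumpTensor v e x i j ^ 2)
    + (∑ e, ((M.edgeLen e) ^ (m + 1))⁻¹ * M.edgeIntegral e fun x => M.jumpNormal v e x ^ 2))

end StokesDG

end

/-!
The only feature of the approximation space that matters is that its members are piecewise
polynomial of degree at most `m`. Both assertions follow from the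
weighted Young inequality once the averages on the edges are controlled by the broken Dirichlet
energy, `∑_e h_e ‖{∇v}‖²_e ≤ t ∑_K ‖∇v‖²_K` with `t` depending only on `N`, `σ` and `m`
(`exists_avgEnergy_le`). For coercivity the consistency terms are absorbed by half of the
Dirichlet energy and by the penalty `2 t / h_e` (`PolyMesh.le_bilin_self`). For boundedness every
term of `B_h(u, v)` is bounded by a multiple of `s ‖u‖² + s⁻¹ ‖v‖²` for all `s > 0`, and optimizing
in `s` gives the product (`PolyMesh.abs_bilin_le`).

The trace inequality has to cope with edges that are much shorter than the sides of the triangles,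
and with edges that run along several triangles of very different size. Both are handled without
looking at the conformity of the triangulation (`exists_trace_inequality`). Let `q` be a component
of `∇v` on an element `K`, and let `e` be an edge of `K`. Since `∂K` is contained in the
boundaries of at most `N` triangles, one of them, `T`, satisfies `h_e ≤ N ℓ` where `ℓ` is the
length of `e ∩ ∂T`. As `ℓ ≤ 3 h_T`, the edge `e` lies within a distance comparable to `h_T` of a
disk of radius `r ≳ h_T / σ` inscribed in `T`. The norms on polynomials of degree at most `m`
being equivalent, scaling gives `r² q² ≤ C ‖q‖²` at the points of `e`, with the `L²` norm over the
disk on the right (`exists_sq_le_integral_ball`); here it is used that `q` is one polynomial on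
all of `K`. The parts `e ∩ ∂T` of different edges are disjoint up to endpoints, so the squares of
the lengths `ℓ` add up to at most `(3 h_T)²`. Hence the sum of `h_e ‖q‖²_e` over the edges that
choose `T` is bounded by a multiple of the square of the `L²` norm of `q` on `K`, and there are at
most `N` triangles `T`.
-/

namespace StokesDG

/-! ### Polynomials on balls -/

/-- Composition with polynomials of degree at most one does not raise the total degree. -/
theorem totalDegree_bind₁_le (q : MvPolynomial (Fin 2) ℝ) (g : Fin 2 → MvPolynomial (Fin 2) ℝ)
    (hg : ∀ i, (g i).totalDegree ≤ 1) : (MvPolynomial.bind₁ g q).totalDegree ≤ q.totalDegree := by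
  rw [MvPolynomial.bind₁, MvPolynomial.aeval_def, MvPolynomial.eval₂_eq']
  refine MvPolynomial.totalDegree_finsetSum_le fun d hd => ?_
  refine (MvPolynomial.totalDegree_mul _ _).trans ?_
  rw [MvPolynomial.algebraMap_eq, MvPolynomial.totalDegree_C, zero_add]
  refine (MvPolynomial.totalDegree_finsetProd _ _).trans (le_trans ?_
    (MvPolynomial.le_totalDegree hd))
  rw [Finsupp.sum_fintype _ _ (fun _ => rfl)]
  refine Finset.sum_le_sum fun i _ => (MvPolynomial.totalDegree_pow _ _).trans ?_
  simpa using Nat.mul_le_mul_left (d i) (hg i)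

theorem totalDegree_pderiv_le (q : MvPolynomial (Fin 2) ℝ) (j : Fin 2) :
    (MvPolynomial.pderiv j q).totalDegree ≤ q.totalDegree := by
  classical
  conv_lhs => rw [q.as_sum]
  rw [map_sum]
  refine MvPolynomial.totalDegree_finsetSum_le fun d hd => ?_
  rw [MvPolynomial.pderiv_monomial]
  refine (MvPolynomial.totalDegree_monomial_le _ _).trans
    (le_trans ?_ (MvPolynomial.le_totalDegree hd))
  rw [Finsupp.sum_fintype _ _ (fun _ => rfl), Finsupp.sum_fintype _ _ (fun _ => rfl)]
  exact Finset.sum_le_sum fun i _ => by simp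

theorem continuous_eval (q : MvPolynomial (Fin 2) ℝ) :
    Continuous fun x : Plane => MvPolynomial.eval (fun k => x k) q :=
  (MvPolynomial.continuous_eval q).comp (by fun_prop)

theorem eval_memLp_ball (q : MvPolynomial (Fin 2) ℝ) :
    MemLp (fun x : Plane => MvPolynomial.eval (fun k => x k) q) 2
      (volume.restrict (Metric.ball 0 1)) := by
  have h := (continuous_eval q).continuousOn (s := Metric.closedBall (0 : Plane) 1)
  have h2 : MemLp (fun x : Plane => MvPolynomial.eval (fun k => x k) q) 2
      (volume.restrict (Metric.closedBall 0 1)) :=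
    (memLp_two_iff_integrable_sq (continuous_eval q).aestronglyMeasurable).2
      ((h.pow 2).integrableOn_compact (isCompact_closedBall _ _))
  exact h2.mono_measure (Measure.restrict_mono Metric.ball_subset_closedBall le_rfl)

/-- A polynomial that vanishes almost everywhere on the unit disk is zero. -/
theorem eq_zero_of_ae_ball (q : MvPolynomial (Fin 2) ℝ)
    (h : ∀ᵐ x : Plane ∂volume.restrict (Metric.ball 0 1), MvPolynomial.eval (fun k => x k) q = 0) :
    q = 0 := by
  have h1 : EqOn (fun x : Plane => MvPolynomial.eval (fun k => x k) q) (fun _ => 0)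
      (Metric.ball 0 1) :=
    Measure.eqOn_open_of_ae_eq h Metric.isOpen_ball (continuous_eval q).continuousOn
      continuousOn_const
  refine MvPolynomial.funext_set (fun _ => Ioo (-1 / 2 : ℝ) (1 / 2))
    (fun _ => Ioo_infinite (by norm_num)) fun x hx => ?_
  have hx0 := hx 0 (mem_univ _)
  have hx1 := hx 1 (mem_univ _)
  have := h1 (x := WithLp.toLp 2 x) (by
    rw [mem_ball_zero_iff, EuclideanSpace.norm_eq, Real.sqrt_lt' one_pos]
    simp only [Fin.sum_univ_two, Real.norm_eq_abs, sq_abs]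
    nlinarith [hx0.1, hx0.2, hx1.1, hx1.2])
  simpa using this

/-- On the polynomials of bounded degree, the supremum over a large disk is controlled by the `L²`
norm over the unit disk, since both are norms on a finite-dimensional space. -/
theorem exists_sq_le_integral_unit_ball (m : ℕ) (R : ℝ) :
    ∃ C > (0 : ℝ), ∀ q : MvPolynomial (Fin 2) ℝ, q.totalDegree ≤ m →
      ∀ x ∈ Metric.closedBall (0 : Plane) R, MvPolynomial.eval (fun k => x k) q ^ 2 ≤
        C * ∫ y in Metric.ball (0 : Plane) 1, MvPolynomial.eval (fun k => y k) q ^ 2 := by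
  set W := MvPolynomial.restrictTotalDegree (Fin 2) ℝ m
  let B := Metric.closedBall (0 : Plane) R
  have : CompactSpace B := isCompact_iff_compactSpace.1 (isCompact_closedBall _ _)
  let L : W →ₗ[ℝ] Lp ℝ 2 (volume.restrict (Metric.ball (0 : Plane) 1)) :=
    { toFun := fun q => (eval_memLp_ball q.1).toLp _
      map_add' := fun p q => by
        rw [← MemLp.toLp_add]; congr 1; ext x; simp
      map_smul' := fun a p => by
        rw [RingHom.id_apply, ← MemLp.toLp_const_smul]; congr 1; ext x; simp }
  have hL : Function.Injective L := by
    refine (injective_iff_map_eq_zero L).2 fun q hq => Subtype.ext (eq_zero_of_ae_ball q.1 ?_)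
    have h1 := (eval_memLp_ball q.1).coeFn_toLp
    have h2 := Lp.eq_zero_iff_ae_eq_zero.1 hq
    filter_upwards [h1, h2] with x hx1 hx2
    rw [← hx1]; exact hx2
  let E : W →ₗ[ℝ] C(B, ℝ) :=
    { toFun := fun q => ⟨fun x => MvPolynomial.eval (fun k => x.1 k) q.1,
        (continuous_eval q.1).comp continuous_subtype_val⟩
      map_add' := fun p q => by ext x; simp
      map_smul' := fun a p => by ext x; simp }
  let e := LinearEquiv.ofInjective L hL
  let F : LinearMap.range L →L[ℝ] C(B, ℝ) :=
    LinearMap.toContinuousLinearMap (E ∘ₗ e.symm.toLinearMap)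
  refine ⟨‖F‖ ^ 2 + 1, by positivity, fun q hq x hx => ?_⟩
  let q' : W := ⟨q, (MvPolynomial.mem_restrictTotalDegree _ _ _).2 hq⟩
  have h1 : F (e q') = E q' := by simp [F]
  have h2 : ‖MvPolynomial.eval (fun k => x k) q‖ ≤ ‖F‖ * ‖L q'‖ := by
    refine ((E q').norm_coe_le_norm ⟨x, hx⟩).trans ?_
    rw [← h1]
    exact F.le_opNorm _
  have h3 : ‖L q'‖ ^ 2 =
      ∫ y in Metric.ball (0 : Plane) 1, MvPolynomial.eval (fun k => y k) q ^ 2 := by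
    rw [← real_inner_self_eq_norm_sq, L2.inner_def]
    refine integral_congr_ae ?_
    filter_upwards [(eval_memLp_ball q).coeFn_toLp] with y hy
    have : (L q' : Plane → ℝ) y = MvPolynomial.eval (fun k => y k) q := hy
    rw [this]; simp [sq]
  rw [← h3, ← sq_abs, ← Real.norm_eq_abs]
  calc _ ≤ (‖F‖ * ‖L q'‖) ^ 2 := by gcongr
    _ ≤ _ := by nlinarith [sq_nonneg ‖L q'‖]

/-- The scaled form of `exists_sq_le_integral_unit_ball`. -/
theorem exists_sq_le_integral_ball (m : ℕ) (R : ℝ) :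
    ∃ C > (0 : ℝ), ∀ q : MvPolynomial (Fin 2) ℝ, q.totalDegree ≤ m →
      ∀ (c : Plane) (r : ℝ), 0 < r → ∀ x ∈ Metric.closedBall c (R * r),
        r ^ 2 * MvPolynomial.eval (fun k => x k) q ^ 2 ≤
          C * ∫ y in Metric.ball c r, MvPolynomial.eval (fun k => y k) q ^ 2 := by
  obtain ⟨C, hC, h⟩ := exists_sq_le_integral_unit_ball m R
  refine ⟨C, hC, fun q hq c r hr x hx => ?_⟩
  let g : Fin 2 → MvPolynomial (Fin 2) ℝ := fun i =>
    MvPolynomial.C (c i) + MvPolynomial.C r * MvPolynomial.X i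
  have hg : ∀ i, (g i).totalDegree ≤ 1 := fun i => by
    refine (MvPolynomial.totalDegree_add _ _).trans (max_le (by simp) ?_)
    refine (MvPolynomial.totalDegree_mul _ _).trans (by simp)
  have hev : ∀ y : Plane, MvPolynomial.eval (fun k => y k) (MvPolynomial.bind₁ g q) =
      MvPolynomial.eval (fun k => (c + r • y) k) q := fun y => by
    rw [MvPolynomial.eval, MvPolynomial.eval₂Hom_bind₁]
    congr 2
    ext i; simp [g]
  have hx' : r⁻¹ • (x - c) ∈ Metric.closedBall (0 : Plane) R := by
    rw [mem_closedBall_zero_iff, norm_smul, norm_inv, Real.norm_of_nonneg hr.le, inv_mul_le_iff₀ hr,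
      mul_comm, ← dist_eq_norm]
    exact hx
  have h1 := h _ ((totalDegree_bind₁_le q g hg).trans hq) _ hx'
  simp only [hev] at h1
  rw [smul_inv_smul₀ hr.ne', add_sub_cancel] at h1
  have h2 : ∫ y in Metric.ball c r, MvPolynomial.eval (fun k => y k) q ^ 2 =
      r ^ 2 * ∫ y in Metric.ball (0 : Plane) 1,
        MvPolynomial.eval (fun k => (c + r • y) k) q ^ 2 := by
    rw [Measure.setIntegral_comp_smul_of_pos volume
      (fun y : Plane => MvPolynomial.eval (fun k => (c + y) k) q ^ 2) _ hr]
    rw [smul_unitBall hr.ne', Real.norm_of_nonneg hr.le]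
    have h3 := (measurePreserving_add_left (volume : Measure Plane) c).setIntegral_preimage_emb
      (measurableEmbedding_addLeft c) (fun y => MvPolynomial.eval (fun k => y k) q ^ 2)
      (Metric.ball c r)
    rw [← h3, show (fun y => c + y) ⁻¹' Metric.ball c r = Metric.ball (0 : Plane) r by
      ext y; simp [dist_eq_norm]]
    simp only [finrank_euclideanSpace, Fintype.card_fin, smul_eq_mul]
    rw [mul_inv_cancel_left₀ (by positivity)]
  rw [h2]
  calc _ ≤ r ^ 2 * _ := mul_le_mul_of_nonneg_left h1 (by positivity)
    _ = _ := by ring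

/-! ### Triangles -/

theorem IsTriangle.affineSpan_eq_top {s : Finset Plane} (hs : IsTriangle s) :
    affineSpan ℝ (range ((↑) : s → Plane)) = ⊤ := by
  rw [AffineIndependent.affineSpan_eq_top_iff_card_eq_finrank_add_one hs.2]
  simp [hs.1]

theorem isCompact_closedTri (s : Finset Plane) : IsCompact (closedTri s) :=
  s.finite_toSet.isCompact_convexHull ℝ

/-- The boundary of a triangle consists of its three sides. -/
theorem IsTriangle.frontier_closedTri_subset {s : Finset Plane} (hs : IsTriangle s) :
    frontier (closedTri s) ⊆ ⋃ v ∈ s, closedTri (s.erase v) := by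
  let b : AffineBasis s ℝ Plane := ⟨(↑), hs.2, hs.affineSpan_eq_top⟩
  have hr : range b = (s : Set Plane) := Subtype.range_coe
  intro x hx
  rw [(isCompact_closedTri s).isClosed.frontier_eq] at hx
  obtain ⟨hx1, hx2⟩ := hx
  rw [closedTri, ← hr, b.convexHull_eq_nonneg_coord] at hx1
  rw [closedTri, ← hr, b.interior_convexHull] at hx2
  simp only [mem_ofPred_eq, not_forall, not_lt] at hx1 hx2
  obtain ⟨i, hi⟩ := hx2
  have hi0 : b.coord i x = 0 := le_antisymm hi (hx1 i)
  refine mem_iUnion₂.2 ⟨i.1, i.2, ?_⟩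
  rw [← b.linear_combination_coord_eq_self x, ← Finset.add_sum_erase _ _ (Finset.mem_univ i), hi0,
    zero_smul, zero_add]
  refine (convex_convexHull ℝ _).sum_mem (fun j _ => hx1 j) ?_ fun j hj => subset_convexHull ℝ _ ?_
  · rw [← b.sum_coord_apply_eq_one x, ← Finset.add_sum_erase _ _ (Finset.mem_univ i), hi0, zero_add]
  · rw [Finset.mem_coe, Finset.mem_erase]
    exact ⟨fun h => Finset.ne_of_mem_erase hj (Subtype.ext h), j.2⟩

theorem IsTriangle.hausdorffMeasure_frontier_le {s : Finset Plane} (hs : IsTriangle s) :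
    μH[1] (frontier (closedTri s)) ≤ ENNReal.ofReal (3 * triDiam s) := by
  have hside : ∀ v ∈ s, μH[1] (closedTri (s.erase v)) ≤ ENNReal.ofReal (triDiam s) := by
    intro v hv
    obtain ⟨x, y, -, hxy⟩ := Finset.card_eq_two.1
      (show (s.erase v).card = 2 by rw [Finset.card_erase_of_mem hv, hs.1])
    have hx : x ∈ s := Finset.mem_of_mem_erase (hxy ▸ Finset.mem_insert_self x {y})
    have hy : y ∈ s := Finset.mem_of_mem_erase
      (hxy ▸ Finset.mem_insert_of_mem (Finset.mem_singleton_self y))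
    rw [closedTri, hxy, Finset.coe_pair, convexHull_pair, hausdorffMeasure_segment, edist_dist]
    exact ENNReal.ofReal_le_ofReal (Metric.dist_le_diam_of_mem (isCompact_closedTri s).isBounded
      (subset_convexHull ℝ _ hx) (subset_convexHull ℝ _ hy))
  refine (measure_mono hs.frontier_closedTri_subset).trans
    ((measure_biUnion_finset_le _ _).trans ((Finset.sum_le_sum hside).trans ?_))
  rw [Finset.sum_const, hs.1, ENNReal.ofReal_mul (by norm_num)]
  simp

/-- A triangle with `h_T ≤ σ ρ_T` contains a disk whose radius is comparable to the diameter of the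
triangle. The supremum `ρ_T` need not be known to be attained: half of it serves as the radius. -/
theorem IsTriangle.exists_closedBall_subset {s : Finset Plane} (hs : IsTriangle s) {σ : ℝ}
    (hσ : triDiam s / triInradius s ≤ σ) :
    ∃ (c : Plane) (r : ℝ), 0 < r ∧ Metric.closedBall c r ⊆ closedTri s ∧
      triDiam s ≤ 2 * |σ| * r := by
  set A := {r : ℝ | 0 ≤ r ∧ ∃ c : Plane, Metric.closedBall c r ⊆ closedTri s}
  have hbdd : BddAbove A := by
    refine ⟨triDiam s, ?_⟩
    rintro r ⟨hr, c, hc⟩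
    obtain ⟨u, hu⟩ := exists_norm_eq Plane hr
    calc r = dist (c + u) c := by simp [hu]
      _ ≤ _ := Metric.dist_le_diam_of_mem (isCompact_closedTri s).isBounded
        (hc (by simp [hu])) (hc (Metric.mem_closedBall_self hr))
  have hint : (interior (closedTri s)).Nonempty := by
    have := hs.affineSpan_eq_top
    rw [Subtype.range_coe] at this
    exact interior_convexHull_nonempty_iff_affineSpan_eq_top.2 this
  obtain ⟨z, hz⟩ := hint
  obtain ⟨r₀, hr₀, hz⟩ := Metric.nhds_basis_closedBall.mem_iff.1 (mem_interior_iff_mem_nhds.1 hz)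
  have hmem : r₀ ∈ A := ⟨hr₀.le, z, hz⟩
  have hρ : 0 < triInradius s := hr₀.trans_le (le_csSup hbdd hmem)
  obtain ⟨r, ⟨-, c, hc⟩, hr⟩ := exists_lt_of_lt_csSup ⟨r₀, hmem⟩ (half_lt_self hρ)
  change triInradius s / 2 < r at hr
  refine ⟨c, r, by linarith, hc, ?_⟩
  rw [div_le_iff₀ hρ] at hσ
  have : triInradius s < 2 * r := by linarith
  calc triDiam s ≤ |σ| * triInradius s := hσ.trans (by gcongr; exact le_abs_self σ)
    _ ≤ |σ| * (2 * r) := by gcongr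
    _ = _ := by ring

/-- The boundary of a polygon is contained in the boundaries of its triangles. -/
theorem frontier_region_subset (S : Finset (Finset Plane)) :
    frontier (region S) ⊆ ⋃ s ∈ S, frontier (closedTri s) := by
  refine frontier_interior_subset.trans fun x hx => ?_
  have hcl : IsClosed (⋃ s ∈ S, closedTri s) :=
    S.finite_toSet.isClosed_biUnion fun s _ => (isCompact_closedTri s).isClosed
  rw [hcl.frontier_eq] at hx
  obtain ⟨s, hs, hxs⟩ := mem_iUnion₂.1 hx.1
  refine mem_iUnion₂.2 ⟨s, hs, ?_⟩
  rw [(isCompact_closedTri s).isClosed.frontier_eq]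
  exact ⟨hxs, fun h => hx.2 (interior_mono
    (subset_biUnion_of_mem (u := fun s => closedTri s) hs) h)⟩

theorem isBounded_region (S : Finset (Finset Plane)) : Bornology.IsBounded (region S) :=
  ((Bornology.isBounded_biUnion_finset S).2 fun s _ =>
    (isCompact_closedTri s).isBounded).subset interior_subset

theorem ball_subset_region {S : Finset (Finset Plane)} {s : Finset Plane} (hs : s ∈ S) {c : Plane}
    {r : ℝ} (h : Metric.closedBall c r ⊆ closedTri s) : Metric.ball c r ⊆ region S :=
  interior_maximal (Metric.ball_subset_closedBall.trans
    (h.trans (subset_biUnion_of_mem (u := fun s => closedTri s) hs))) Metric.isOpen_ball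

/-! ### The discrete trace inequality -/

theorem hausdorffMeasure_openSegment (a b : Plane) :
    μH[1] (openSegment ℝ a b) = edist a b := by
  have := Measure.nullSingletonClass_hausdorff Plane one_pos
  rw [← hausdorffMeasure_segment, ← insert_endpoints_openSegment]
  exact measure_congr ((insert_ae_eq_self _ _).trans (insert_ae_eq_self _ _)).symm

theorem measurableSet_openSegment (a b : Plane) : MeasurableSet (openSegment ℝ a b) := by
  rcases eq_or_ne a b with rfl | hab
  · rw [openSegment_same]; exact measurableSet_singleton _
  have h : openSegment ℝ a b = segment ℝ a b \ {a, b} := by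
    rw [← insert_endpoints_openSegment]
    ext x
    simp only [Set.mem_sdiff, mem_insert_iff, mem_singleton_iff]
    constructor
    · intro hx
      refine ⟨Or.inr (Or.inr hx), ?_⟩
      rintro (rfl | rfl)
      · exact hab (left_mem_openSegment_iff.1 hx)
      · exact hab (right_mem_openSegment_iff.1 hx)
    · tauto
  rw [h]
  refine MeasurableSet.diff ?_ ((measurableSet_singleton b).insert a)
  rw [← convexHull_pair]
  exact ((toFinite {a, b}).isCompact_convexHull ℝ).isClosed.measurableSet

/-- The discrete trace inequality for one polygon. A part of at least `1 / N` of every edge lies on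
the boundary of a single triangle of the subdivision, so that the edge stays within a fixed multiple
of the inradius from the disk inscribed in this triangle, on which the polynomial controls itself.
The parts of the different edges on the boundary of one triangle are disjoint, so that the squares
of their lengths add up to at most the square of the perimeter. -/
theorem exists_trace_inequality (N : ℕ) (σ : ℝ) (m : ℕ) :
    ∃ C > (0 : ℝ), ∀ S : Finset (Finset Plane), S.card ≤ N →
      (∀ s ∈ S, IsTriangle s ∧ triDiam s / triInradius s ≤ σ) →
      ∀ {ι : Type} (E : Finset ι) (a b : ι → Plane), (∀ e, a e ≠ b e) →
      (∀ e e', e ≠ e' → Disjoint (openSegment ℝ (a e) (b e)) (openSegment ℝ (a e') (b e'))) →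
      (∀ e ∈ E, segment ℝ (a e) (b e) ⊆ frontier (region S)) →
      ∀ q : MvPolynomial (Fin 2) ℝ, q.totalDegree ≤ m →
      ∑ e ∈ E, dist (a e) (b e) * (dist (a e) (b e) * ∫ t in (0 : ℝ)..1,
          MvPolynomial.eval (fun k => AffineMap.lineMap (a e) (b e) t k) q ^ 2) ≤
        C * ∫ x in region S, MvPolynomial.eval (fun k => x k) q ^ 2 := by
  obtain ⟨C₀, hC₀, hball⟩ := exists_sq_le_integral_ball m ((6 * N + 2) * |σ|)
  refine ⟨36 * N ^ 3 * |σ| ^ 2 * C₀ + 1, by positivity, ?_⟩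
  intro S hN hS ι E a b hab hdisj hE q hq
  set I := ∫ x in region S, MvPolynomial.eval (fun k => x k) q ^ 2 with hI
  have hI0 : 0 ≤ I := integral_nonneg fun x => sq_nonneg _
  choose! c r hr hc hd using fun s hs => (hS s hs).1.exists_closedBall_subset (hS s hs).2
  let l : ι → Finset Plane → ℝ := fun e s =>
    (μH[1] (openSegment ℝ (a e) (b e) ∩ frontier (closedTri s))).toReal
  have hl0 : ∀ e s, 0 ≤ l e s := fun e s => ENNReal.toReal_nonneg
  have hfin : ∀ e s, μH[1] (openSegment ℝ (a e) (b e) ∩ frontier (closedTri s)) ≠ ⊤ := fun e s =>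
    ne_top_of_le_ne_top (by rw [hausdorffMeasure_openSegment]; exact edist_ne_top _ _)
      (measure_mono inter_subset_left)
  have hsum : ∀ s ∈ S, ∑ e ∈ E, l e s ≤ 6 * |σ| * r s := by
    intro s hs
    have h0 : 0 ≤ triDiam s := Metric.diam_nonneg
    rw [← ENNReal.toReal_sum fun e _ => hfin e s, ← measure_biUnion_finset
      (fun e _ e' _ hee' => (hdisj e e' hee').mono inter_subset_left inter_subset_left)
      (fun e _ => (measurableSet_openSegment _ _).inter isClosed_frontier.measurableSet)]
    refine (ENNReal.toReal_mono ENNReal.ofReal_ne_top ((measure_mono (iUnion₂_subset fun e _ =>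
      inter_subset_right)).trans (hS s hs).1.hausdorffMeasure_frontier_le)).trans ?_
    rw [ENNReal.toReal_ofReal (by positivity)]
    linarith [hd s hs]
  have hpick : ∀ e ∈ E, ∃ s ∈ S, dist (a e) (b e) ≤ N * l e s := by
    intro e he
    have hsub := (hE e he).trans (frontier_region_subset S)
    obtain ⟨s₀, hs₀, -⟩ := mem_iUnion₂.1 (hsub (left_mem_segment ℝ _ _))
    obtain ⟨s, hs, hmax⟩ := S.exists_max_image (l e) ⟨s₀, hs₀⟩
    refine ⟨s, hs, ?_⟩
    have h1 : edist (a e) (b e) ≤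
        ∑ s ∈ S, μH[1] (openSegment ℝ (a e) (b e) ∩ frontier (closedTri s)) := by
      rw [← hausdorffMeasure_openSegment]
      refine (measure_mono fun x hx => ?_).trans (measure_biUnion_finset_le _ _)
      obtain ⟨s, hs, hxs⟩ := mem_iUnion₂.1 (hsub (openSegment_subset_segment ℝ _ _ hx))
      exact mem_iUnion₂.2 ⟨s, hs, hx, hxs⟩
    have h2 := ENNReal.toReal_mono (ENNReal.sum_ne_top.2 fun s _ => hfin e s) h1
    rw [ENNReal.toReal_sum fun s _ => hfin e s, ← dist_edist] at h2
    calc dist (a e) (b e) ≤ ∑ s ∈ S, l e s := h2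
      _ ≤ S.card • l e s := Finset.sum_le_card_nsmul _ _ _ hmax
      _ ≤ N * l e s := by
        rw [nsmul_eq_mul]
        exact mul_le_mul_of_nonneg_right (by exact_mod_cast hN) (hl0 e s)
  choose! τ hτ hlen using hpick
  have hpoint : ∀ e ∈ E, ∀ x ∈ segment ℝ (a e) (b e),
      r (τ e) ^ 2 * MvPolynomial.eval (fun k => x k) q ^ 2 ≤ C₀ * I := by
    intro e he x hx
    have hs := hτ e he
    have hpos : 0 < l e (τ e) := by
      refine (hl0 _ _).lt_of_ne fun h => ?_
      have := hlen e he
      rw [← h, mul_zero] at this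
      exact (dist_pos.2 (hab e)).not_ge this
    obtain ⟨y, hy⟩ : (openSegment ℝ (a e) (b e) ∩ frontier (closedTri (τ e))).Nonempty := by
      by_contra h
      rw [not_nonempty_iff_eq_empty] at h
      exact hpos.ne' (by simp only [l, h, measure_empty, ENNReal.toReal_zero])
    have hyT : y ∈ closedTri (τ e) := (isCompact_closedTri _).isClosed.frontier_subset hy.2
    have h1 : dist x y ≤ dist (a e) (b e) := by
      have hbd : Bornology.IsBounded (segment ℝ (a e) (b e)) := by
        rw [← convexHull_pair]
        exact isBounded_convexHull.2 (toFinite _).isBounded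
      have h := Metric.dist_le_diam_of_mem hbd hx (openSegment_subset_segment ℝ _ _ hy.1)
      rwa [← convexHull_pair, convexHull_diam, Metric.diam_pair] at h
    have h2 : dist y (c (τ e)) ≤ triDiam (τ e) :=
      Metric.dist_le_diam_of_mem (isCompact_closedTri _).isBounded hyT
        (hc _ hs (Metric.mem_closedBall_self (hr _ hs).le))
    have h3 : l e (τ e) ≤ 6 * |σ| * r (τ e) :=
      (Finset.single_le_sum (f := fun e' => l e' (τ e)) (fun e' _ => hl0 e' _) he).trans
        (hsum _ hs)
    have h4 : dist (a e) (b e) ≤ N * (6 * |σ| * r (τ e)) :=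
      (hlen e he).trans (by gcongr)
    refine (hball q hq (c (τ e)) (r (τ e)) (hr _ hs) x ?_).trans ?_
    · rw [Metric.mem_closedBall]
      linarith [dist_triangle x y (c (τ e)), hd _ hs]
    · refine mul_le_mul_of_nonneg_left (setIntegral_mono_set ?_ ?_ ?_) hC₀.le
      · exact (((continuous_eval q).pow 2).continuousOn.integrableOn_compact
          (isBounded_region S).isCompact_closure).mono_set subset_closure
      · exact Eventually.of_forall fun x => sq_nonneg _
      · exact (ball_subset_region hs (hc _ hs)).eventuallyLE
  have hedge : ∀ e ∈ E, dist (a e) (b e) * (dist (a e) (b e) * ∫ t in (0 : ℝ)..1,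
      MvPolynomial.eval (fun k => AffineMap.lineMap (a e) (b e) t k) q ^ 2) ≤
      ∑ s ∈ S, N ^ 2 * C₀ * I / r s ^ 2 * l e s ^ 2 := by
    intro e he
    have hs := hτ e he
    have hr2 : 0 < r (τ e) ^ 2 := pow_pos (hr _ hs) 2
    have h1 : ∫ t in (0 : ℝ)..1,
        MvPolynomial.eval (fun k => AffineMap.lineMap (a e) (b e) t k) q ^ 2 ≤
        C₀ * I / r (τ e) ^ 2 := by
      have hcont : Continuous fun t : ℝ =>
          MvPolynomial.eval (fun k => AffineMap.lineMap (a e) (b e) t k) q ^ 2 :=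
        ((continuous_eval q).comp AffineMap.lineMap_continuous).pow 2
      calc _ ≤ ∫ t in (0 : ℝ)..1, C₀ * I / r (τ e) ^ 2 := by
            refine intervalIntegral.integral_mono_on zero_le_one (hcont.intervalIntegrable _ _)
              (continuous_const.intervalIntegrable _ _) fun t ht => ?_
            rw [le_div_iff₀ hr2, mul_comm]
            refine hpoint e he _ ?_
            rw [segment_eq_image_lineMap]
            exact ⟨t, ht, rfl⟩
        _ = _ := by simp
    calc _ ≤ dist (a e) (b e) * (dist (a e) (b e) * (C₀ * I / r (τ e) ^ 2)) := by gcongr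
      _ = dist (a e) (b e) ^ 2 * (C₀ * I / r (τ e) ^ 2) := by ring
      _ ≤ (N * l e (τ e)) ^ 2 * (C₀ * I / r (τ e) ^ 2) := by
        have := hlen e he
        gcongr
      _ = N ^ 2 * C₀ * I / r (τ e) ^ 2 * l e (τ e) ^ 2 := by ring
      _ ≤ _ := Finset.single_le_sum (f := fun s => N ^ 2 * C₀ * I / r s ^ 2 * l e s ^ 2)
        (fun s _ => by positivity) hs
  calc _ ≤ ∑ e ∈ E, ∑ s ∈ S, N ^ 2 * C₀ * I / r s ^ 2 * l e s ^ 2 := Finset.sum_le_sum hedge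
    _ = ∑ s ∈ S, N ^ 2 * C₀ * I / r s ^ 2 * ∑ e ∈ E, l e s ^ 2 := by
      rw [Finset.sum_comm]
      simp only [Finset.mul_sum]
    _ ≤ ∑ s ∈ S, 36 * N ^ 2 * |σ| ^ 2 * C₀ * I := by
      refine Finset.sum_le_sum fun s hs => ?_
      have hrs := hr s hs
      calc _ ≤ N ^ 2 * C₀ * I / r s ^ 2 * (6 * |σ| * r s) ^ 2 := by
            refine mul_le_mul_of_nonneg_left ?_ (by positivity)
            refine (Finset.sum_sq_le_sq_sum_of_nonneg fun e _ => hl0 e s).trans ?_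
            exact pow_le_pow_left₀ (Finset.sum_nonneg fun e _ => hl0 e s) (hsum s hs) 2
        _ = _ := by field_simp; ring
    _ = S.card * (36 * N ^ 2 * |σ| ^ 2 * C₀ * I) := by rw [Finset.sum_const, nsmul_eq_mul]
    _ ≤ N * (36 * N ^ 2 * |σ| ^ 2 * C₀ * I) := by
      refine mul_le_mul_of_nonneg_right (by exact_mod_cast hN) (by positivity)
    _ ≤ _ := by nlinarith

/-! ### Integrals over elements and edges -/

variable {Ω : Set Plane} (M : PolyMesh Ω)

@[fun_prop]
theorem PolyField.continuous_val (p : PolyField) (i : Fin 2) : Continuous fun x => p.val x i :=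
  continuous_eval _

@[fun_prop]
theorem PolyField.continuous_grad (p : PolyField) (i j : Fin 2) :
    Continuous fun x => p.grad x i j :=
  continuous_eval _

@[fun_prop]
theorem PolyMesh.continuous_jumpTensor (v : Fin M.numElems → PolyField) (e : Fin M.numEdges)
    (i j : Fin 2) : Continuous fun x => M.jumpTensor v e x i j := by
  unfold PolyMesh.jumpTensor
  split <;> fun_prop

@[fun_prop]
theorem PolyMesh.continuous_jumpNormal (v : Fin M.numElems → PolyField) (e : Fin M.numEdges) :
    Continuous fun x => M.jumpNormal v e x := by
  unfold PolyMesh.jumpNormal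
  split <;> fun_prop

@[fun_prop]
theorem PolyMesh.continuous_avgGrad (v : Fin M.numElems → PolyField) (e : Fin M.numEdges)
    (i j : Fin 2) : Continuous fun x => M.avgGrad v e x i j := by
  unfold PolyMesh.avgGrad
  split <;> fun_prop

theorem PolyMesh.edgeLen_pos (e : Fin M.numEdges) : 0 < M.edgeLen e := dist_pos.2 (M.a_ne_b e)

theorem PolyMesh.edgeIntegral_nonneg (e : Fin M.numEdges) {f : Plane → ℝ} (hf : ∀ x, 0 ≤ f x) :
    0 ≤ M.edgeIntegral e f :=
  mul_nonneg (M.edgeLen_pos e).le (intervalIntegral.integral_nonneg zero_le_one fun _ _ => hf _)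

theorem PolyMesh.edgeIntegral_mono (e : Fin M.numEdges) {f g : Plane → ℝ} (hf : Continuous f)
    (hg : Continuous g) (h : ∀ x, f x ≤ g x) : M.edgeIntegral e f ≤ M.edgeIntegral e g :=
  mul_le_mul_of_nonneg_left (intervalIntegral.integral_mono zero_le_one
    ((hf.comp AffineMap.lineMap_continuous).intervalIntegrable _ _)
    ((hg.comp AffineMap.lineMap_continuous).intervalIntegrable _ _) fun _ => h _)
    (M.edgeLen_pos e).le

theorem PolyMesh.edgeIntegral_sum (e : Fin M.numEdges) {ι : Type} (s : Finset ι)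
    {f : ι → Plane → ℝ} (hf : ∀ i, Continuous (f i)) :
    M.edgeIntegral e (fun x => ∑ i ∈ s, f i x) = ∑ i ∈ s, M.edgeIntegral e (f i) := by
  unfold PolyMesh.edgeIntegral
  rw [intervalIntegral.integral_finsetSum, Finset.mul_sum]
  exact fun i _ => ((hf i).comp AffineMap.lineMap_continuous).intervalIntegrable _ _

theorem PolyMesh.integrableOn_elem (K : Fin M.numElems) {f : Plane → ℝ} (hf : Continuous f) :
    IntegrableOn f (M.elem K) := by
  obtain ⟨-, S, -, hS⟩ := M.isPolygon K
  rw [hS]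
  exact (hf.continuousOn.integrableOn_compact (isBounded_region S).isCompact_closure).mono_set
    subset_closure

/-- An integral inherits a weighted Young inequality from its integrand. -/
theorem abs_integral_le_of_young {α : Type*} [MeasurableSpace α] {μ : Measure α} {F G H : α → ℝ}
    {s : ℝ} (hF : Integrable F μ) (hG : Integrable G μ) (hH : Integrable H μ)
    (h : ∀ x, |F x| ≤ (s * G x + s⁻¹ * H x) / 2) :
    |∫ x, F x ∂μ| ≤ (s * ∫ x, G x ∂μ + s⁻¹ * ∫ x, H x ∂μ) / 2 := by
  rw [← integral_const_mul, ← integral_const_mul, ← integral_add (hG.const_mul s)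
    (hH.const_mul s⁻¹), ← integral_div]
  exact abs_integral_le_integral_abs.trans (integral_mono hF.abs
    (((hG.const_mul s).add (hH.const_mul s⁻¹)).div_const 2) h)

theorem PolyMesh.abs_edgeIntegral_le_of_young (e : Fin M.numEdges) {F G H : Plane → ℝ} {s : ℝ}
    (hF : Continuous F) (hG : Continuous G) (hH : Continuous H)
    (h : ∀ x, |F x| ≤ (s * G x + s⁻¹ * H x) / 2) :
    |M.edgeIntegral e F| ≤ (s * M.edgeIntegral e G + s⁻¹ * M.edgeIntegral e H) / 2 := by
  have hint : ∀ {f : Plane → ℝ}, Continuous f → Integrable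
      (fun t : ℝ => f (AffineMap.lineMap (M.a e) (M.b e) t)) (volume.restrict (Ioc 0 1)) :=
    fun hf => ((hf.comp AffineMap.lineMap_continuous).continuousOn.integrableOn_compact
      isCompact_Icc).mono_set Ioc_subset_Icc_self
  unfold PolyMesh.edgeIntegral
  simp only [intervalIntegral.integral_of_le zero_le_one]
  rw [abs_mul, abs_of_pos (M.edgeLen_pos e)]
  have := mul_le_mul_of_nonneg_left (abs_integral_le_of_young (hint hF) (hint hG) (hint hH)
    fun t => h _) (M.edgeLen_pos e).le
  linarith

theorem abs_mul_le_young {s : ℝ} (hs : 0 < s) (x y : ℝ) :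
    |x * y| ≤ (s * x ^ 2 + s⁻¹ * y ^ 2) / 2 := by
  have h : s * x ^ 2 + s⁻¹ * y ^ 2 - 2 * |x * y| = s⁻¹ * (s * |x| - |y|) ^ 2 := by
    rw [abs_mul, ← sq_abs x, ← sq_abs y]
    field_simp
    ring
  have : 0 ≤ s⁻¹ * (s * |x| - |y|) ^ 2 := by positivity
  linarith

theorem abs_contraction_le_young {s : ℝ} (hs : 0 < s) (f g : Fin 2 → Fin 2 → ℝ) :
    |∑ i, ∑ j, f i j * g i j| ≤
      (s * (∑ i, ∑ j, f i j ^ 2) + s⁻¹ * ∑ i, ∑ j, g i j ^ 2) / 2 := by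
  calc |∑ i, ∑ j, f i j * g i j| ≤ ∑ i, ∑ j, (s * f i j ^ 2 + s⁻¹ * g i j ^ 2) / 2 :=
        (Finset.abs_sum_le_sum_abs _ _).trans (Finset.sum_le_sum fun i _ =>
          (Finset.abs_sum_le_sum_abs _ _).trans (Finset.sum_le_sum fun j _ =>
            abs_mul_le_young hs _ _))
    _ = _ := by simp only [Fin.sum_univ_two]; ring

/-! ### The parts of the energy norm -/

/-- The broken Dirichlet energy `∑_K ‖∇v‖²_K`. -/
noncomputable def PolyMesh.gradEnergy (v : Fin M.numElems → PolyField) : ℝ :=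
  ∑ K, ∫ x in M.elem K, ∑ i, ∑ j, (v K).grad x i j ^ 2

/-- The weighted jumps `∑_e h_e⁻¹ ‖[[v ⊗ n]]‖²_e`. -/
noncomputable def PolyMesh.tensorEnergy (v : Fin M.numElems → PolyField) : ℝ :=
  ∑ e, (M.edgeLen e)⁻¹ * M.edgeIntegral e fun x => ∑ i, ∑ j, M.jumpTensor v e x i j ^ 2

/-- The weighted normal jumps `∑_e h_e^{-(m+1)} ‖[[v · n]]‖²_e`. -/
noncomputable def PolyMesh.normalEnergy (m : ℕ) (v : Fin M.numElems → PolyField) : ℝ :=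
  ∑ e, ((M.edgeLen e) ^ (m + 1))⁻¹ * M.edgeIntegral e fun x => M.jumpNormal v e x ^ 2

/-- The weighted averages `∑_e h_e ‖{∇v}‖²_e`. -/
noncomputable def PolyMesh.avgEnergy (v : Fin M.numElems → PolyField) : ℝ :=
  ∑ e, M.edgeLen e * M.edgeIntegral e fun x => ∑ i, ∑ j, M.avgGrad v e x i j ^ 2

theorem PolyMesh.gradEnergy_nonneg (v : Fin M.numElems → PolyField) : 0 ≤ M.gradEnergy v :=
  Finset.sum_nonneg fun _ _ => integral_nonneg fun _ =>
    Finset.sum_nonneg fun _ _ => Finset.sum_nonneg fun _ _ => sq_nonneg _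

theorem PolyMesh.tensorEnergy_nonneg (v : Fin M.numElems → PolyField) : 0 ≤ M.tensorEnergy v :=
  Finset.sum_nonneg fun e _ => mul_nonneg (inv_nonneg.2 (M.edgeLen_pos e).le)
    (M.edgeIntegral_nonneg e fun _ =>
      Finset.sum_nonneg fun _ _ => Finset.sum_nonneg fun _ _ => sq_nonneg _)

theorem PolyMesh.normalEnergy_nonneg (m : ℕ) (v : Fin M.numElems → PolyField) :
    0 ≤ M.normalEnergy m v :=
  Finset.sum_nonneg fun e _ => mul_nonneg (inv_nonneg.2 (pow_pos (M.edgeLen_pos e) _).le)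
    (M.edgeIntegral_nonneg e fun _ => sq_nonneg _)

theorem PolyMesh.energyNorm_sq (m : ℕ) (v : Fin M.numElems → PolyField) :
    M.energyNorm m v ^ 2 = M.gradEnergy v + M.tensorEnergy v + M.normalEnergy m v :=
  Real.sq_sqrt (add_nonneg (add_nonneg (M.gradEnergy_nonneg v) (M.tensorEnergy_nonneg v))
    (M.normalEnergy_nonneg m v))

theorem PatchData.totalDegree_le_of_mem_space {M : PolyMesh Ω} {P : PatchData M} {m : ℕ}
    {v : Fin M.numElems → PolyField} (hv : v ∈ P.space m) (K : Fin M.numElems) (i : Fin 2) :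
    (v K i).totalDegree ≤ m := by
  obtain ⟨w, hw⟩ := hv
  exact (hw K).1.1 i

/-- At a point of an edge, the square of the average is at most the sum of the squares of the
gradients on the adjacent elements. -/
theorem PolyMesh.avgGrad_sq_le (v : Fin M.numElems → PolyField) (e : Fin M.numEdges) (x : Plane)
    (i j : Fin 2) : M.avgGrad v e x i j ^ 2 ≤
      ∑ K with M.pos e = K ∨ M.neg e = some K, (v K).grad x i j ^ 2 := by
  unfold PolyMesh.avgGrad
  split
  · rename_i K hK
    have hne := M.neg_ne e K hK
    calc _ ≤ (v (M.pos e)).grad x i j ^ 2 + (v K).grad x i j ^ 2 := by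
          nlinarith [sq_nonneg ((v (M.pos e)).grad x i j - (v K).grad x i j),
            sq_nonneg ((v (M.pos e)).grad x i j + (v K).grad x i j)]
      _ = ∑ L ∈ {M.pos e, K}, (v L).grad x i j ^ 2 := 
        (Finset.sum_pair (f := fun L => (v L).grad x i j ^ 2) hne.symm).symm
      _ ≤ _ := Finset.sum_le_sum_of_subset_of_nonneg
        (fun L hL => by
          rw [Finset.mem_filter]
          rcases Finset.mem_insert.1 hL with rfl | hL
          · exact ⟨Finset.mem_univ _, Or.inl rfl⟩
          · rw [Finset.mem_singleton.1 hL]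
            exact ⟨Finset.mem_univ _, Or.inr hK⟩)
        fun _ _ _ => sq_nonneg _
  · exact Finset.single_le_sum (f := fun K => (v K).grad x i j ^ 2) (fun _ _ => sq_nonneg _)
      (Finset.mem_filter.2 ⟨Finset.mem_univ _, Or.inl rfl⟩)

/-- The discrete trace inequality on a mesh. -/
theorem exists_avgEnergy_le (N : ℕ) (σ : ℝ) (m : ℕ) :
    ∃ C > (0 : ℝ), ∀ (Ω : Set Plane) (M : PolyMesh Ω), M.ShapeRegular N σ →
      ∀ v : Fin M.numElems → PolyField, (∀ K i, (v K i).totalDegree ≤ m) →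
        M.avgEnergy v ≤ C * M.gradEnergy v := by
  obtain ⟨C, hC, h⟩ := exists_trace_inequality N σ m
  refine ⟨C, hC, fun Ω M ⟨S, hN, hel, hS, _⟩ v hv => ?_⟩
  have hcg : ∀ K i j, Continuous fun x => (v K).grad x i j ^ 2 := fun K i j =>
    ((v K).continuous_grad i j).pow 2
  have hlocal : ∀ K i j, ∑ e with M.pos e = K ∨ M.neg e = some K,
      M.edgeLen e * M.edgeIntegral e (fun x => (v K).grad x i j ^ 2) ≤
        C * ∫ x in M.elem K, (v K).grad x i j ^ 2 := by
    intro K i j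
    have := h (S K) (hN K) (hS K) {e | M.pos e = K ∨ M.neg e = some K} M.a M.b M.a_ne_b
      M.edges_disjoint (fun e he => by
        rw [← hel K]
        rcases (Finset.mem_filter.1 he).2 with rfl | he
        · exact M.pos_subset e
        · exact M.neg_subset e K he) (MvPolynomial.pderiv j (v K i))
      ((totalDegree_pderiv_le _ _).trans (hv K i))
    rw [← hel K] at this
    exact this
  calc M.avgEnergy v ≤ ∑ e, ∑ K with M.pos e = K ∨ M.neg e = some K, ∑ i, ∑ j,
        M.edgeLen e * M.edgeIntegral e (fun x => (v K).grad x i j ^ 2) := by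
        refine Finset.sum_le_sum fun e _ => ?_
        have h1 : M.edgeIntegral e (fun x => ∑ i, ∑ j, M.avgGrad v e x i j ^ 2) ≤
            M.edgeIntegral e (fun x => ∑ K with M.pos e = K ∨ M.neg e = some K, ∑ i, ∑ j,
              (v K).grad x i j ^ 2) := by
          refine M.edgeIntegral_mono e (by fun_prop) (by fun_prop) fun x => ?_
          calc _ ≤ ∑ i, ∑ j, ∑ K with M.pos e = K ∨ M.neg e = some K, (v K).grad x i j ^ 2 :=
                Finset.sum_le_sum fun i _ => Finset.sum_le_sum fun j _ =>
                  M.avgGrad_sq_le v e x i j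
            _ = _ := by
                symm
                rw [Finset.sum_comm]
                exact Finset.sum_congr rfl fun i _ => Finset.sum_comm
        refine (mul_le_mul_of_nonneg_left h1 (M.edgeLen_pos e).le).trans_eq ?_
        rw [M.edgeIntegral_sum e _ fun K => by fun_prop, Finset.mul_sum]
        refine Finset.sum_congr rfl fun K _ => ?_
        rw [M.edgeIntegral_sum e _ fun i => by fun_prop, Finset.mul_sum]
        refine Finset.sum_congr rfl fun i _ => ?_
        rw [M.edgeIntegral_sum e _ fun j => by fun_prop, Finset.mul_sum]
    _ = ∑ K, ∑ e with M.pos e = K ∨ M.neg e = some K, ∑ i, ∑ j,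
        M.edgeLen e * M.edgeIntegral e (fun x => (v K).grad x i j ^ 2) :=
        Finset.sum_comm' fun _ _ => by simp
    _ = ∑ K, ∑ i, ∑ j, ∑ e with M.pos e = K ∨ M.neg e = some K,
        M.edgeLen e * M.edgeIntegral e (fun x => (v K).grad x i j ^ 2) := by
        refine Finset.sum_congr rfl fun K _ => ?_
        rw [Finset.sum_comm]
        exact Finset.sum_congr rfl fun i _ => Finset.sum_comm
    _ ≤ ∑ K, ∑ i, ∑ j, C * ∫ x in M.elem K, (v K).grad x i j ^ 2 :=
        Finset.sum_le_sum fun K _ => Finset.sum_le_sum fun i _ => Finset.sum_le_sum fun j _ =>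
          hlocal K i j
    _ = C * M.gradEnergy v := by
        rw [PolyMesh.gradEnergy, Finset.mul_sum]
        refine Finset.sum_congr rfl fun K _ => ?_
        have hint := fun i j => M.integrableOn_elem K (hcg K i j)
        rw [integral_finsetSum _ fun i _ => integrable_finsetSum _ fun j _ => hint i j,
          Finset.mul_sum]
        refine Finset.sum_congr rfl fun i _ => ?_
        rw [integral_finsetSum _ fun j _ => hint i j, Finset.mul_sum]

/-! ### Bounds for the terms of the bilinear form -/

theorem PolyMesh.abs_sum_grad_le (u v : Fin M.numElems → PolyField) {s : ℝ} (hs : 0 < s) :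
    |∑ K, ∫ x in M.elem K, ∑ i, ∑ j, (u K).grad x i j * (v K).grad x i j| ≤
      (s * M.gradEnergy u + s⁻¹ * M.gradEnergy v) / 2 := by
  refine (Finset.abs_sum_le_sum_abs _ _).trans ?_
  rw [PolyMesh.gradEnergy, PolyMesh.gradEnergy, Finset.mul_sum, Finset.mul_sum,
    ← Finset.sum_add_distrib, Finset.sum_div]
  refine Finset.sum_le_sum fun K _ => ?_
  have hF : Continuous fun x => ∑ i, ∑ j, (u K).grad x i j * (v K).grad x i j := by fun_prop
  have hG : Continuous fun x => ∑ i, ∑ j, (u K).grad x i j ^ 2 := by fun_prop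
  have hH : Continuous fun x => ∑ i, ∑ j, (v K).grad x i j ^ 2 := by fun_prop
  exact abs_integral_le_of_young (M.integrableOn_elem K hF) (M.integrableOn_elem K hG)
    (M.integrableOn_elem K hH) fun x => abs_contraction_le_young hs ((u K).grad x) ((v K).grad x)

theorem PolyMesh.abs_sum_consistency_le (u v : Fin M.numElems → PolyField) {s : ℝ} (hs : 0 < s) :
    |∑ e, M.edgeIntegral e fun x => ∑ i, ∑ j, M.jumpTensor u e x i j * M.avgGrad v e x i j| ≤
      (s * M.tensorEnergy u + s⁻¹ * M.avgEnergy v) / 2 := by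
  refine (Finset.abs_sum_le_sum_abs _ _).trans ?_
  rw [PolyMesh.tensorEnergy, PolyMesh.avgEnergy, Finset.mul_sum, Finset.mul_sum,
    ← Finset.sum_add_distrib, Finset.sum_div]
  refine Finset.sum_le_sum fun e _ => ?_
  -- The Young parameter `s / h_e` produces the weights `h_e⁻¹` and `h_e` of the two energies.
  have h := M.abs_edgeIntegral_le_of_young e (by fun_prop) (by fun_prop) (by fun_prop)
    fun x => abs_contraction_le_young (mul_pos hs (inv_pos.2 (M.edgeLen_pos e)))
      (M.jumpTensor u e x) (M.avgGrad v e x)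
  rwa [mul_inv, inv_inv, mul_assoc, mul_assoc] at h

/-- The weighted Young inequality for a sum of penalty terms. -/
theorem PolyMesh.abs_sum_penalty_le {A s : ℝ} {κ ω : Fin M.numEdges → ℝ}
    (hκ : ∀ e, |κ e| ≤ A * ω e) {F G H : Fin M.numEdges → Plane → ℝ}
    (hF : ∀ e, Continuous (F e)) (hG : ∀ e, Continuous (G e)) (hH : ∀ e, Continuous (H e))
    (h : ∀ e x, |F e x| ≤ (s * G e x + s⁻¹ * H e x) / 2) :
    |∑ e, κ e * M.edgeIntegral e (F e)| ≤
      A * ((s * (∑ e, ω e * M.edgeIntegral e (G e)) +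
        s⁻¹ * ∑ e, ω e * M.edgeIntegral e (H e)) / 2) := by
  refine (Finset.abs_sum_le_sum_abs _ _).trans ?_
  rw [Finset.mul_sum, Finset.mul_sum, ← Finset.sum_add_distrib, Finset.sum_div, Finset.mul_sum]
  refine Finset.sum_le_sum fun e _ => ?_
  rw [abs_mul]
  refine (mul_le_mul (hκ e) (M.abs_edgeIntegral_le_of_young e (hF e) (hG e) (hH e) (h e))
    (abs_nonneg _) ((abs_nonneg _).trans (hκ e))).trans_eq ?_
  ring

/-- A bound by weighted squares, uniform in the weight, gives a bound by the product. -/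
theorem le_mul_of_forall_weight {b C X Y : ℝ} (hC : 0 ≤ C) (hX : 0 ≤ X) (hY : 0 ≤ Y)
    (h : ∀ s > 0, b ≤ C * ((s * X ^ 2 + s⁻¹ * Y ^ 2) / 2)) : b ≤ C * (X * Y) := by
  -- The optimal weight is `Y / X`; adding `δ` avoids the case of a zero factor.
  have h1 : ∀ δ > 0, b ≤ C * ((X + δ) * (Y + δ)) := by
    intro δ hδ
    have hXδ : 0 < X + δ := by positivity
    have hYδ : 0 < Y + δ := by positivity
    refine (h ((Y + δ) / (X + δ)) (by positivity)).trans (mul_le_mul_of_nonneg_left ?_ hC)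
    have e1 : (Y + δ) / (X + δ) * X ^ 2 ≤ (X + δ) * (Y + δ) := by
      calc _ ≤ (Y + δ) / (X + δ) * (X + δ) ^ 2 := by gcongr; linarith
        _ = _ := by field_simp
    have e2 : ((Y + δ) / (X + δ))⁻¹ * Y ^ 2 ≤ (X + δ) * (Y + δ) := by
      calc _ ≤ ((Y + δ) / (X + δ))⁻¹ * (Y + δ) ^ 2 := by gcongr; linarith
        _ = _ := by field_simp
    linarith
  have hcont : Continuous fun δ : ℝ => C * ((X + δ) * (Y + δ)) := by fun_prop
  have hlim : Tendsto (fun δ : ℝ => C * ((X + δ) * (Y + δ))) (𝓝[>] 0) (𝓝 (C * (X * Y))) := by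
    simpa using (hcont.tendsto 0).mono_left nhdsWithin_le_nhds
  exact ge_of_tendsto hlim (eventually_mem_nhdsWithin.mono h1)

/-- Boundedness of the bilinear form, from the bound `t` for the averages. -/
theorem PolyMesh.abs_bilin_le {m : ℕ} {t A : ℝ} (ht : 0 ≤ t) {u v : Fin M.numElems → PolyField}
    (hu : M.avgEnergy u ≤ t * M.gradEnergy u) (hv : M.avgEnergy v ≤ t * M.gradEnergy v)
    {η ε : Fin M.numEdges → ℝ} (hη : ∀ e, |η e| ≤ |A| * (M.edgeLen e)⁻¹)
    (hε : ∀ e, |ε e| ≤ |A| * ((M.edgeLen e) ^ (m + 1))⁻¹) :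
    |M.bilin η ε u v| ≤ (2 + t + |A|) * (M.energyNorm m u * M.energyNorm m v) := by
  have hA := abs_nonneg A
  refine le_mul_of_forall_weight (by positivity) (Real.sqrt_nonneg _) (Real.sqrt_nonneg _)
    fun s hs => ?_
  have hs' := inv_pos.2 hs
  have b1 := M.abs_sum_grad_le u v hs
  have b2 := M.abs_sum_consistency_le u v hs
  have b3 := M.abs_sum_consistency_le v u hs'
  rw [inv_inv] at b3
  have b4 := M.abs_sum_penalty_le hη (by fun_prop) (by fun_prop) (by fun_prop) fun e x =>
    abs_contraction_le_young hs (M.jumpTensor u e x) (M.jumpTensor v e x)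
  have b5 := M.abs_sum_penalty_le hε (by fun_prop) (by fun_prop) (by fun_prop) fun e x =>
    abs_mul_le_young hs (M.jumpNormal u e x) (M.jumpNormal v e x)
  have hcomm : (∑ e, M.edgeIntegral e fun x =>
      ∑ i, ∑ j, M.avgGrad u e x i j * M.jumpTensor v e x i j) = ∑ e, M.edgeIntegral e fun x =>
      ∑ i, ∑ j, M.jumpTensor v e x i j * M.avgGrad u e x i j := by
    simp only [mul_comm]
  rw [PolyMesh.bilin, hcomm, M.energyNorm_sq, M.energyNorm_sq]
  change _ ≤ |A| * ((s * M.tensorEnergy u + s⁻¹ * M.tensorEnergy v) / 2) at b4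
  change _ ≤ |A| * ((s * M.normalEnergy m u + s⁻¹ * M.normalEnergy m v) / 2) at b5
  have hgu := M.gradEnergy_nonneg u
  have hgv := M.gradEnergy_nonneg v
  have htu := M.tensorEnergy_nonneg u
  have htv := M.tensorEnergy_nonneg v
  have hmu := M.normalEnergy_nonneg m u
  have hmv := M.normalEnergy_nonneg m v
  have c1 := mul_le_mul_of_nonneg_left hu hs.le
  have c2 := mul_le_mul_of_nonneg_left hv hs'.le
  have d1 : 0 ≤ (s * M.gradEnergy u + s⁻¹ * M.gradEnergy v) / 2 := by positivity
  have d2 : 0 ≤ (s * M.tensorEnergy u + s⁻¹ * M.tensorEnergy v) / 2 := by positivity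
  have d3 : 0 ≤ (s * M.normalEnergy m u + s⁻¹ * M.normalEnergy m v) / 2 := by positivity
  have d4 := mul_nonneg hA d1
  have d5 := mul_nonneg ht d2
  have d6 := mul_nonneg ht d3
  rw [abs_le] at *
  constructor <;> linarith [b1.1, b1.2, b2.1, b2.2, b3.1, b3.2, b4.1, b4.2, b5.1, b5.2]

/-- Coercivity of the bilinear form, from the bound `t` for the averages. -/
theorem PolyMesh.le_bilin_self {m : ℕ} {t : ℝ} (ht : 0 < t) {v : Fin M.numElems → PolyField}
    (hv : M.avgEnergy v ≤ t * M.gradEnergy v) {η ε : Fin M.numEdges → ℝ}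
    (hη : ∀ e, (2 * t + 1 / 2) * (M.edgeLen e)⁻¹ ≤ η e)
    (hε : ∀ e, 1 / 2 * ((M.edgeLen e) ^ (m + 1))⁻¹ ≤ ε e) :
    1 / 2 * M.energyNorm m v ^ 2 ≤ M.bilin η ε v v := by
  -- With the weight `2 t`, the consistency terms cost half of the Dirichlet energy.
  have b2 := M.abs_sum_consistency_le v v (s := 2 * t) (by positivity)
  have b4 : (2 * t + 1 / 2) * M.tensorEnergy v ≤ ∑ e, η e * M.edgeIntegral e fun x =>
      ∑ i, ∑ j, M.jumpTensor v e x i j * M.jumpTensor v e x i j := by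
    simp only [← sq]
    rw [PolyMesh.tensorEnergy, Finset.mul_sum]
    refine Finset.sum_le_sum fun e _ => ?_
    rw [← mul_assoc]
    exact mul_le_mul_of_nonneg_right (hη e) (M.edgeIntegral_nonneg e fun x =>
      Finset.sum_nonneg fun _ _ => Finset.sum_nonneg fun _ _ => sq_nonneg _)
  have b5 : 1 / 2 * M.normalEnergy m v ≤ ∑ e, ε e * M.edgeIntegral e fun x =>
      M.jumpNormal v e x * M.jumpNormal v e x := by
    simp only [← sq]
    rw [PolyMesh.normalEnergy, Finset.mul_sum]
    refine Finset.sum_le_sum fun e _ => ?_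
    rw [← mul_assoc]
    exact mul_le_mul_of_nonneg_right (hε e) (M.edgeIntegral_nonneg e fun x => sq_nonneg _)
  have hcomm : (∑ e, M.edgeIntegral e fun x =>
      ∑ i, ∑ j, M.avgGrad v e x i j * M.jumpTensor v e x i j) = ∑ e, M.edgeIntegral e fun x =>
      ∑ i, ∑ j, M.jumpTensor v e x i j * M.avgGrad v e x i j := by
    simp only [mul_comm]
  have b1 : (∑ K, ∫ x in M.elem K, ∑ i, ∑ j, (v K).grad x i j * (v K).grad x i j) =
      M.gradEnergy v := by
    simp only [← sq]
    rfl
  have c1 : (2 * t)⁻¹ * M.avgEnergy v ≤ M.gradEnergy v / 2 := by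
    calc _ ≤ (2 * t)⁻¹ * (t * M.gradEnergy v) := by gcongr
      _ = _ := by field_simp
  rw [PolyMesh.bilin, hcomm, b1, M.energyNorm_sq]
  linarith [(abs_le.1 b2).2]

end StokesDG

theorem mainTheorem6 (N : ℕ) (σ : ℝ) (m : ℕ) :
    ∃ η₀ > (0 : ℝ), ∃ ε₀ > (0 : ℝ), ∃ c > (0 : ℝ), ∀ A : ℝ, ∃ C > (0 : ℝ),
      ∀ (Ω : Set StokesDG.Plane) (M : StokesDG.PolyMesh Ω) (P : StokesDG.PatchData M),
        StokesDG.IsPolygon Ω → M.ShapeRegular N σ → P.Unisolvent m →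
        ∀ η ε : Fin M.numEdges → ℝ,
          (∀ e, η₀ * (M.edgeLen e)⁻¹ ≤ η e) →
          (∀ e, ε₀ * ((M.edgeLen e) ^ (m + 1))⁻¹ ≤ ε e) →
          ((∀ e, η e ≤ A * (M.edgeLen e)⁻¹) →
            (∀ e, ε e ≤ A * ((M.edgeLen e) ^ (m + 1))⁻¹) →
            ∀ u ∈ P.space m, ∀ v ∈ P.space m,
              |M.bilin η ε u v| ≤ C * (M.energyNorm m u * M.energyNorm m v)) ∧
          (∀ v ∈ P.space m, c * M.energyNorm m v ^ 2 ≤ M.bilin η ε v v) := by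
  obtain ⟨t, ht, htrace⟩ := StokesDG.exists_avgEnergy_le N σ m
  refine ⟨2 * t + 1 / 2, by positivity, 1 / 2, by norm_num, 1 / 2, by norm_num, fun A =>
    ⟨2 + t + |A|, by positivity, fun Ω M P _ hM _ η ε hη hε => ⟨fun hηA hεA u hu v hv => ?_,
      fun v hv => ?_⟩⟩⟩
  · have hw : ∀ e, 0 < (M.edgeLen e)⁻¹ := fun e => inv_pos.2 (M.edgeLen_pos e)
    have hw' : ∀ e, 0 < ((M.edgeLen e) ^ (m + 1))⁻¹ := fun e =>
      inv_pos.2 (pow_pos (M.edgeLen_pos e) _)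
    refine M.abs_bilin_le ht.le (htrace Ω M hM u fun K i => P.totalDegree_le_of_mem_space hu K i)
      (htrace Ω M hM v fun K i => P.totalDegree_le_of_mem_space hv K i) (fun e => ?_) fun e => ?_
    · rw [abs_of_nonneg ((mul_pos (by positivity) (hw e)).le.trans (hη e))]
      exact (hηA e).trans (mul_le_mul_of_nonneg_right (le_abs_self A) (hw e).le)
    · rw [abs_of_nonneg ((mul_pos (by positivity) (hw' e)).le.trans (hε e))]
      exact (hεA e).trans (mul_le_mul_of_nonneg_right (le_abs_self A) (hw' e).le)
  · exact M.le_bilin_self ht (htrace Ω M hM v fun K i => P.totalDegree_le_of_mem_space hv K i)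
      hη hε
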